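/- Let $m > n \ge 2$ and $0 \le \ell \le m$ be integers. Let $\mathcal{P}^{\ell}_{m,n}$ be the set of real positive semidefinite $m \times m$ matrices of rank $n$ having at least $\ell$ diagonal entries equal to each other, with the Zariski topology induced from the affine space $\mathbb{R}^{m\times m}$ of real $m \times m$ matrices. If $A$ and $B$ are real symmetric $m\times m$ matrices, $B$ is called a symmetric rearrangement of $A$ if $B_{ii} = A_{ii}$ for all $i$ and the sets of triples $\{(A_{ii}, A_{jj}, A_{ij}) : 1 \le i, j \le m\}$ and $\{(B_{ii}, B_{jj}, B_{ij}) : 1 \le i, j \le m\}$ are equal. If $A$ is positive semidefinite of rank $n$, then $B$ is called equivalent to $A$ if there is a real $n \times m$ matrix $X$ with $A = X^{\top} X$ and a matrix $Y$ obtained from $X$ by permuting its columns such that $B = Y^{\top} Y$. Then there exists a Zariski open and Zariski dense subset $U^{\ell}_{m,n}$ of $\mathcal{P}^{\ell}_{m,n}$ such that, for every $A \in U^{\ell}_{m,n}$, every symmetric rearrangement of $A$ that is not equivalent to $A$ has rank greater than $n$. -/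

import Mathlib

namespace Beltway

/-- The set of real positive semidefinite `m × m` matrices of rank exactly `n` such that at least
`ℓ` of the diagonal entries are equal to each other. -/
def psdRankDiag (m n ℓ : ℕ) : Set (Matrix (Fin m) (Fin m) ℝ) :=
  {A | A.PosSemidef ∧ A.rank = n ∧
    ∃ I : Finset (Fin m), ℓ ≤ I.card ∧ ∀ i ∈ I, ∀ j ∈ I, A i i = A j j}

/-- The set of triples `(A i i, A j j, A i j)`. -/
def triples {m : ℕ} (A : Matrix (Fin m) (Fin m) ℝ) : Set (ℝ × ℝ × ℝ) :=
  {t | ∃ i j : Fin m, t = (A i i, A j j, A i j)}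

/-- `B` is a symmetric rearrangement of `A`: both matrices are symmetric, they have the same
diagonal, and they have the same set of triples. -/
def IsSymmRearrangement {m : ℕ} (A B : Matrix (Fin m) (Fin m) ℝ) : Prop :=
  A.IsSymm ∧ B.IsSymm ∧ (∀ i, B i i = A i i) ∧ triples B = triples A

/-- `B` is equivalent to `A`: there is a Gram factorization `A = Xᵀ X` with `X` of size `n × m`
such that `B = Yᵀ Y`, where `Y` is obtained by permuting the columns of `X`. -/
def IsGramEquivalent {m : ℕ} (n : ℕ) (A B : Matrix (Fin m) (Fin m) ℝ) : Prop :=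
  ∃ (X : Matrix (Fin n) (Fin m) ℝ) (σ : Equiv.Perm (Fin m)),
    A = X.transpose * X ∧ B = (X.submatrix id σ).transpose * X.submatrix id σ

/-- A set of real `m × m` matrices is Zariski closed if it is the common zero set of a set of
real polynomials in the `m * m` matrix entries. -/
def IsZariskiClosed {m : ℕ} (C : Set (Matrix (Fin m) (Fin m) ℝ)) : Prop :=
  ∃ S : Set (MvPolynomial (Fin m × Fin m) ℝ),
    C = {A | ∀ f ∈ S, MvPolynomial.eval (fun p => A p.1 p.2) f = 0}

/-- `U` is a Zariski open subset of `P`, for the Zariski topology induced on `P`. -/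
def IsZariskiOpenIn {m : ℕ} (U P : Set (Matrix (Fin m) (Fin m) ℝ)) : Prop :=
  ∃ C, IsZariskiClosed C ∧ U = P \ C

/-- `U` is Zariski dense in `P`: every Zariski closed set that contains `U` contains `P`. -/
def IsZariskiDenseIn {m : ℕ} (U P : Set (Matrix (Fin m) (Fin m) ℝ)) : Prop :=
  ∀ C, IsZariskiClosed C → U ⊆ C → P ⊆ C

end Beltway

/-! `U` is cut out by finitely many inequations: differences of entries, and the minors of order `n
+ 1` of all matrices obtained by permuting entries, keeping only those polynomials that are nonzero
at the Gram matrix of some unit vectors in `ℝⁿ`. Unit vectors satisfy every prescribed coincidence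
of norms, and each set of configurations with such coincidences is irreducible
(`exists_mul_ne_zero_of_norm_eq`); hence density.

Let `A ∈ U` and let `B` be a rearrangement of rank at most `n`. Distinctness of entries makes `B`
come from a permutation `ρ` of unordered pairs fixing the diagonal. The minors of `B` vanish, so by
the choice of `U` they vanish on all unit configurations (`MinorsVanish`). Special configurations
then constrain `ρ`. Orthonormal labellings of sparse graphs show that cliques on `n + 1` vertices
correspond to cliques (`MinorsVanish.exists_completeEdges`). Three coplanar unit vectors, completed
orthonormally, give a nonsingular minor unless `ρ` preserves adjacency of edges and then triangles
(`MinorsVanish.adjacent`, `MinorsVanish.triangle`). So `ρ` is induced by a vertex permutation, which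
also preserves the diagonal values, and `B` is equivalent to `A`. -/

namespace Beltway

open scoped Matrix

/-! ### Irreducibility by analytic curves -/

/-- Any two unit vectors in a space of dimension at least two lie on an analytic curve of unit
vectors. -/
theorem exists_analytic_unit_curve {n : ℕ} (hn : 2 ≤ n) (u v : EuclideanSpace ℝ (Fin n))
    (hu : ‖u‖ = 1) (hv : ‖v‖ = 1) :
    ∃ γ : ℝ → EuclideanSpace ℝ (Fin n), AnalyticOnNhd ℝ γ Set.univ ∧ (∀ t, ‖γ t‖ = 1) ∧
      γ 0 = u ∧ γ 1 = v := by
  -- The curve is a great circle: `w` is the normalized component of `v` orthogonal to `u`, and `θ =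
  -- arccos ⟪u, v⟫`.
  obtain ⟨w, hw, huw, θ, hθ⟩ : ∃ w : EuclideanSpace ℝ (Fin n), ‖w‖ = 1 ∧ inner ℝ u w = 0 ∧
      ∃ θ : ℝ, v = Real.cos θ • u + Real.sin θ • w := by
    set c := inner ℝ u v with hc
    set p := v - c • u with hp
    have hup : inner ℝ u p = 0 := by
      simp [hp, inner_sub_right, inner_smul_right, hu, hc]
    have hcp : c ^ 2 + ‖p‖ ^ 2 = 1 := by
      have h1 : v = c • u + p := by simp [hp]
      have h2 : ‖v‖ ^ 2 = c ^ 2 + ‖p‖ ^ 2 := by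
        conv_lhs => rw [h1]
        rw [norm_add_sq_real, inner_smul_left, hup, norm_smul, hu]
        simp
      rw [← h2, hv]; norm_num
    have hc1 : c ≤ 1 := by nlinarith [sq_nonneg ‖p‖]
    have hc2 : -1 ≤ c := by nlinarith [sq_nonneg ‖p‖]
    have hsin : Real.sin (Real.arccos c) = ‖p‖ := by
      rw [Real.sin_arccos, show 1 - c ^ 2 = ‖p‖ ^ 2 by linarith, Real.sqrt_sq (norm_nonneg _)]
    by_cases h0 : p = 0
    -- Here `v = ±u`, so any direction orthogonal to `u` serves; `2 ≤ n` provides one.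
    · obtain ⟨w, hw, huw⟩ : ∃ w : EuclideanSpace ℝ (Fin n), w ≠ 0 ∧ inner ℝ u w = 0 := by
        have hlt : Module.finrank ℝ (Submodule.span ℝ {u}) <
            Module.finrank ℝ (EuclideanSpace ℝ (Fin n)) := by
          rw [finrank_euclideanSpace_fin]
          exact (finrank_span_singleton (by rintro rfl; simp at hu)).trans_lt (by omega)
        have hne : (Submodule.span ℝ {u})ᗮ ≠ ⊥ := by
          intro h
          rw [Submodule.orthogonal_eq_bot_iff] at h
          rw [h, finrank_top] at hlt
          exact lt_irrefl _ hlt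
        obtain ⟨w, hw, hw0⟩ := Submodule.exists_mem_ne_zero_of_ne_bot hne
        exact ⟨w, hw0, Submodule.mem_orthogonal_singleton_iff_inner_right.1 hw⟩
      refine ⟨(‖w‖⁻¹ : ℝ) • w, ?_, ?_, Real.arccos c, ?_⟩
      · simp [norm_smul, hw]
      · simp [inner_smul_right, huw]
      · rw [hsin, Real.cos_arccos hc2 hc1, h0]
        simp only [norm_zero, zero_smul, add_zero]
        exact sub_eq_zero.1 (hp ▸ h0)
    · have hp0 : ‖p‖ ≠ 0 := norm_ne_zero_iff.2 h0
      refine ⟨(‖p‖⁻¹ : ℝ) • p, ?_, ?_, Real.arccos c, ?_⟩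
      · simp [norm_smul, h0]
      · simp [inner_smul_right, hup]
      · rw [hsin, Real.cos_arccos hc2 hc1, smul_smul, mul_inv_cancel₀ hp0, one_smul]
        simp [hp]
  refine ⟨fun t => Real.cos (θ * t) • u + Real.sin (θ * t) • w, ?_, ?_, ?_, ?_⟩
  · intro t _
    fun_prop
  · intro t
    have h : ‖Real.cos (θ * t) • u + Real.sin (θ * t) • w‖ ^ 2 = 1 := by
      rw [norm_add_sq_real, inner_smul_left, inner_smul_right, huw, norm_smul, norm_smul, hu, hw]
      simp
    nlinarith [norm_nonneg (Real.cos (θ * t) • u + Real.sin (θ * t) • w)]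
  · simp
  · simp [hθ]

theorem exists_eq_norm_smul_unit {n : ℕ} (hn : 2 ≤ n) (x : EuclideanSpace ℝ (Fin n)) :
    ∃ u : EuclideanSpace ℝ (Fin n), ‖u‖ = 1 ∧ x = ‖x‖ • u := by
  by_cases hx : x = 0
  · exact ⟨EuclideanSpace.single ⟨0, by omega⟩ 1, by simp, by simp [hx]⟩
  · refine ⟨(‖x‖⁻¹ : ℝ) • x, by simp [norm_smul, hx], ?_⟩
    rw [smul_smul, mul_inv_cancel₀ (norm_ne_zero_iff.2 hx), one_smul]

/-- Irreducibility of the set of configurations with prescribed coincidences of norms: two analytic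
functions that do not vanish identically on it have a common point of nonvanishing. -/
theorem exists_mul_ne_zero_of_norm_eq {m n : ℕ} (hn : 2 ≤ n) (I : Finset (Fin m))
    {f g : (Fin m → EuclideanSpace ℝ (Fin n)) → ℝ}
    (hf : AnalyticOnNhd ℝ f Set.univ) (hg : AnalyticOnNhd ℝ g Set.univ)
    {x y : Fin m → EuclideanSpace ℝ (Fin n)}
    (hx : ∀ i ∈ I, ∀ j ∈ I, ‖x i‖ = ‖x j‖) (hy : ∀ i ∈ I, ∀ j ∈ I, ‖y i‖ = ‖y j‖)
    (hfx : f x ≠ 0) (hgy : g y ≠ 0) :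
    ∃ z : Fin m → EuclideanSpace ℝ (Fin n), (∀ i ∈ I, ∀ j ∈ I, ‖z i‖ = ‖z j‖) ∧
      f z * g z ≠ 0 := by
  choose u hu hxu using fun i => exists_eq_norm_smul_unit hn (x i)
  choose v hv hyv using fun i => exists_eq_norm_smul_unit hn (y i)
  choose γ hγ hγ1 hγu hγv using fun i => exists_analytic_unit_curve hn (u i) (v i) (hu i) (hv i)
  -- Interpolating lengths and directions separately keeps the norms on `I` equal for every real
  -- `t`.
  set z : ℝ → Fin m → EuclideanSpace ℝ (Fin n) :=
    fun t i => ((1 - t) * ‖x i‖ + t * ‖y i‖) • γ i t with hz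
  have hz0 : z 0 = x := by
    funext i
    simp only [hz, hγu]
    rw [sub_zero, one_mul, zero_mul, add_zero]
    exact (hxu i).symm
  have hz1 : z 1 = y := by
    funext i
    simp only [hz, hγv]
    rw [sub_self, zero_mul, one_mul, zero_add]
    exact (hyv i).symm
  have hza : AnalyticOnNhd ℝ z Set.univ := by
    refine analyticOnNhd_pi_iff.2 fun i t _ => ?_
    have := hγ i t trivial
    change AnalyticAt ℝ (fun t : ℝ => ((1 - t) * ‖x i‖ + t * ‖y i‖) • γ i t) t
    fun_prop
  by_contra! hcon
  have hfz : AnalyticOnNhd ℝ (fun t => f (z t)) Set.univ := hf.comp hza (fun _ _ => trivial)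
  have hgz : AnalyticOnNhd ℝ (fun t => g (z t)) Set.univ := hg.comp hza (fun _ _ => trivial)
  have hzI : ∀ t, ∀ i ∈ I, ∀ j ∈ I, ‖z t i‖ = ‖z t j‖ := by
    intro t i hi j hj
    simp only [hz, norm_smul, hγ1, hx i hi j hj, hy i hi j hj]
  -- Analytic functions on the connected line have no zero divisors.
  rcases AnalyticOnNhd.eq_zero_or_eq_zero_of_mul_eq_zero hfz hgz (fun t _ => hcon (z t) (hzI t))
    isPreconnected_univ with h | h
  · exact hfx (hz0 ▸ h 0 trivial)
  · exact hgy (hz1 ▸ h 1 trivial)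

theorem exists_forall_ne_zero_of_norm_eq {m n : ℕ} (hn : 2 ≤ n) (I : Finset (Fin m))
    {ι : Type*} (s : Finset ι) {f : ι → (Fin m → EuclideanSpace ℝ (Fin n)) → ℝ}
    (hf : ∀ k ∈ s, AnalyticOnNhd ℝ (f k) Set.univ)
    (hx : ∀ k ∈ s, ∃ x : Fin m → EuclideanSpace ℝ (Fin n),
      (∀ i ∈ I, ∀ j ∈ I, ‖x i‖ = ‖x j‖) ∧ f k x ≠ 0) :
    ∃ z : Fin m → EuclideanSpace ℝ (Fin n), (∀ i ∈ I, ∀ j ∈ I, ‖z i‖ = ‖z j‖) ∧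
      ∀ k ∈ s, f k z ≠ 0 := by
  classical
  suffices h : ∃ z : Fin m → EuclideanSpace ℝ (Fin n), (∀ i ∈ I, ∀ j ∈ I, ‖z i‖ = ‖z j‖) ∧
      ∏ k ∈ s, f k z ≠ 0 by
    obtain ⟨z, hz, hne⟩ := h
    exact ⟨z, hz, Finset.prod_ne_zero_iff.1 hne⟩
  induction s using Finset.induction_on with
  | empty => exact ⟨0, by simp, by simp⟩
  | insert a s ha ih =>
    obtain ⟨y, hy, hne⟩ := ih (fun k hk => hf k (Finset.mem_insert_of_mem hk))
      (fun k hk => hx k (Finset.mem_insert_of_mem hk))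
    obtain ⟨x, hx, hxne⟩ := hx a (Finset.mem_insert_self a s)
    obtain ⟨z, hz, hzne⟩ := exists_mul_ne_zero_of_norm_eq hn I
      (hf a (Finset.mem_insert_self a s))
      (g := fun z => ∏ k ∈ s, f k z)
      (Finset.analyticOnNhd_fun_prod s fun k hk => hf k (Finset.mem_insert_of_mem hk))
      hx hy hxne hne
    exact ⟨z, hz, by rwa [Finset.prod_insert ha]⟩

/-! ### Gram matrices and Zariski density -/

/-- The matrix whose columns are the given vectors. -/
def colMatrix {m n : ℕ} (x : Fin m → EuclideanSpace ℝ (Fin n)) : Matrix (Fin n) (Fin m) ℝ :=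
  Matrix.of fun k i => x i k

theorem gram_eq_colMatrix {m n : ℕ} (x : Fin m → EuclideanSpace ℝ (Fin n)) :
    Matrix.gram ℝ x = (colMatrix x)ᵀ * colMatrix x := by
  ext i j
  simp [Matrix.mul_apply, colMatrix, PiLp.inner_apply, mul_comm]

/-- With `X` the column matrix, `XᵀX`, `X` and `XXᵀ` have the same rank, and `XXᵀ` is `n × n`. The
rank condition thus becomes nonvanishing of one analytic function. -/
theorem rank_gram_eq_iff {m n : ℕ} (x : Fin m → EuclideanSpace ℝ (Fin n)) :
    (Matrix.gram ℝ x).rank = n ↔ (colMatrix x * (colMatrix x)ᵀ).det ≠ 0 := by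
  rw [gram_eq_colMatrix, Matrix.rank_transpose_mul_self, ← Matrix.rank_self_mul_transpose]
  constructor
  · intro h
    have : LinearMap.range (colMatrix x * (colMatrix x)ᵀ).mulVecLin = ⊤ :=
      Submodule.eq_top_of_finrank_eq (by simpa [Matrix.rank] using h)
    rw [← isUnit_iff_ne_zero, ← Matrix.isUnit_iff_isUnit_det, ← Matrix.mulVec_surjective_iff_isUnit]
    exact LinearMap.range_eq_top.1 this
  · intro h
    rw [Matrix.rank_of_isUnit, Fintype.card_fin]
    rw [Matrix.isUnit_iff_isUnit_det]
    exact isUnit_iff_ne_zero.2 h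

theorem analyticOnNhd_det_colMatrix {m n : ℕ} :
    AnalyticOnNhd ℝ (fun x : Fin m → EuclideanSpace ℝ (Fin n) =>
      (colMatrix x * (colMatrix x)ᵀ).det) Set.univ := by
  intro x _
  simp only [Matrix.det_apply, Matrix.mul_apply, Matrix.transpose_apply, colMatrix, Matrix.of_apply]
  have h : ∀ (i : Fin m) (k : Fin n),
      AnalyticAt ℝ (fun x : Fin m → EuclideanSpace ℝ (Fin n) => x i k) x := fun i k =>
    ((EuclideanSpace.proj k : EuclideanSpace ℝ (Fin n) →L[ℝ] ℝ).comp
      (ContinuousLinearMap.proj (R := ℝ) (φ := fun _ : Fin m => EuclideanSpace ℝ (Fin n)) i)).analyticAt x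
  refine Finset.analyticAt_fun_sum _ fun σ _ => ?_
  refine AnalyticAt.const_smul (Finset.analyticAt_fun_prod _ fun k _ => ?_)
  exact Finset.analyticAt_fun_sum _ fun i _ => (h _ _).mul (h _ _)

theorem analyticOnNhd_eval_gram {m n : ℕ} (f : MvPolynomial (Fin m × Fin m) ℝ) :
    AnalyticOnNhd ℝ (fun x : Fin m → EuclideanSpace ℝ (Fin n) =>
      MvPolynomial.eval (fun p => Matrix.gram ℝ x p.1 p.2) f) Set.univ := by
  refine AnalyticOnNhd.aeval_mvPolynomial (B := ℝ) (fun p => ?_) f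
  intro x _
  simp only [Matrix.gram_apply, PiLp.inner_apply]
  have h' : ∀ (i : Fin m) (k : Fin n),
      AnalyticAt ℝ (fun x : Fin m → EuclideanSpace ℝ (Fin n) => x i k) x := fun i k =>
    ((EuclideanSpace.proj k : EuclideanSpace ℝ (Fin n) →L[ℝ] ℝ).comp
      (ContinuousLinearMap.proj (R := ℝ) (φ := fun _ : Fin m => EuclideanSpace ℝ (Fin n)) i)).analyticAt x
  refine Finset.analyticAt_fun_sum _ fun k _ => ?_
  exact (h' _ _).mul (h' _ _)

/-- A positive semidefinite matrix of rank `n` is a Gram matrix of vectors in `ℝⁿ`. -/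
theorem exists_eq_gram {m n : ℕ} {A : Matrix (Fin m) (Fin m) ℝ} (hA : A.PosSemidef)
    (hr : A.rank = n) : ∃ x : Fin m → EuclideanSpace ℝ (Fin n), A = Matrix.gram ℝ x := by
  obtain ⟨B, rfl⟩ : ∃ B : Matrix (Fin m) (Fin m) ℝ, A = Bᵀ * B := by
    open scoped MatrixOrder in
    obtain ⟨B, hB⟩ := CStarAlgebra.nonneg_iff_eq_star_mul_self.1 hA.nonneg
    exact ⟨B, hB⟩
  rw [Matrix.rank_transpose_mul_self, Matrix.rank_eq_finrank_span_cols] at hr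
  let L := (WithLp.linearEquiv 2 ℝ (Fin m → ℝ)).symm
  let W : Submodule ℝ (EuclideanSpace ℝ (Fin m)) :=
    (Submodule.span ℝ (Set.range B.col)).map L.toLinearMap
  have hW : Module.finrank ℝ W = n := by
    rw [← hr]; exact LinearEquiv.finrank_map_eq L _
  have hmem : ∀ i, L (B.col i) ∈ W := fun i =>
    Submodule.mem_map_of_mem (Submodule.subset_span ⟨i, rfl⟩)
  -- Orthonormal coordinates on the `n`-dimensional column space of `B` preserve inner products,
  -- bringing the columns from `ℝᵐ` to `ℝⁿ`.
  let b := (stdOrthonormalBasis ℝ W).reindex (finCongr hW)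
  refine ⟨fun i => b.repr ⟨L (B.col i), hmem i⟩, ?_⟩
  ext i j
  rw [Matrix.gram_apply, LinearIsometryEquiv.inner_map_map]
  simp [Matrix.mul_apply, PiLp.inner_apply, L, mul_comm]

/-- Finitely many polynomials, each nonvanishing at the Gram matrix of a configuration of unit
vectors, cut out a Zariski open and dense subset. -/
theorem zariski_open_dense_of_forall_unit {m n : ℕ} (ℓ : ℕ) (hn : 2 ≤ n)
    (s : Finset (MvPolynomial (Fin m × Fin m) ℝ))
    (hs : ∀ f ∈ s, ∃ y : Fin m → EuclideanSpace ℝ (Fin n), (∀ i, ‖y i‖ = 1) ∧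
      MvPolynomial.eval (fun p => Matrix.gram ℝ y p.1 p.2) f ≠ 0) :
    IsZariskiOpenIn {A ∈ psdRankDiag m n ℓ | ∀ f ∈ s,
      MvPolynomial.eval (fun p => A p.1 p.2) f ≠ 0} (psdRankDiag m n ℓ) ∧
    IsZariskiDenseIn {A ∈ psdRankDiag m n ℓ | ∀ f ∈ s,
      MvPolynomial.eval (fun p => A p.1 p.2) f ≠ 0} (psdRankDiag m n ℓ) := by
  classical
  constructor
  · refine ⟨_, ⟨{∏ f ∈ s, f}, rfl⟩, ?_⟩
    ext A
    simp [Finset.prod_eq_zero_iff]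
  · rintro C ⟨S, rfl⟩ hU A ⟨hA, hr, I, hI, hd⟩ f hf
    by_contra hne
    obtain ⟨x, rfl⟩ := exists_eq_gram hA hr
    -- If `f` vanishes on `U` but not at `A`, a common nonzero of `f`, of `s` and of the rank
    -- determinant (index `none`) is a point of `U` where `f ≠ 0`.
    have key := exists_forall_ne_zero_of_norm_eq hn I
      (insert none ((insert f s).image some))
      (f := fun k x => match k with
        | none => (colMatrix x * (colMatrix x)ᵀ).det
        | some f => MvPolynomial.eval (fun p => Matrix.gram ℝ x p.1 p.2) f) ?_ ?_
    · obtain ⟨z, hz, hzne⟩ := key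
      have h1 := hzne none (by simp)
      have h2 := hzne (some f) (by simp)
      refine h2 (hU ⟨⟨Matrix.posSemidef_gram ℝ z, (rank_gram_eq_iff z).2 h1, I, hI, ?_⟩, ?_⟩ f hf)
      · intro i hi j hj
        simp [hz i hi j hj]
      · intro g hg
        exact hzne (some g) (by simp [hg])
    · intro k _
      cases k with
      | none => exact analyticOnNhd_det_colMatrix
      | some f => exact analyticOnNhd_eval_gram f
    · have hx : ∀ i ∈ I, ∀ j ∈ I, ‖x i‖ = ‖x j‖ := by
        intro i hi j hj
        have := hd i hi j hj
        simp only [Matrix.gram_apply, real_inner_self_eq_norm_sq] at this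
        exact (sq_eq_sq₀ (norm_nonneg _) (norm_nonneg _)).1 this
      intro k hk
      cases k with
      | none => exact ⟨x, hx, (rank_gram_eq_iff x).1 hr⟩
      | some g =>
        simp only [Finset.mem_insert, reduceCtorEq, Finset.mem_image, Option.some.injEq,
          exists_eq_right, false_or] at hk
        rcases hk with rfl | hg
        · exact ⟨x, hx, hne⟩
        · obtain ⟨y, hy, hyne⟩ := hs g hg
          exact ⟨y, fun i _ j _ => by rw [hy, hy], hyne⟩

/-! ### Sparse graphs and orthonormal labellings -/

/-- The edges of the complete graph on a finite set of vertices. -/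
def completeEdges {m : ℕ} (W : Finset (Fin m)) : Finset (Sym2 (Fin m)) :=
  W.offDiag.image Sym2.mk.uncurry

theorem mk_mem_completeEdges {m : ℕ} {W : Finset (Fin m)} {a b : Fin m} :
    s(a, b) ∈ completeEdges W ↔ a ∈ W ∧ b ∈ W ∧ a ≠ b := by
  simp only [completeEdges, Finset.mem_image, Finset.mem_offDiag, Prod.exists,
    Function.uncurry_apply_pair, Sym2.eq_iff]
  constructor
  · rintro ⟨x, y, ⟨hx, hy, hxy⟩, ⟨rfl, rfl⟩ | ⟨rfl, rfl⟩⟩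
    · exact ⟨hx, hy, hxy⟩
    · exact ⟨hy, hx, hxy.symm⟩
  · rintro ⟨ha, hb, hab⟩
    exact ⟨a, b, ⟨ha, hb, hab⟩, Or.inl ⟨rfl, rfl⟩⟩

theorem card_completeEdges {m : ℕ} (W : Finset (Fin m)) :
    (completeEdges W).card = W.card.choose 2 := Sym2.card_image_offDiag W

theorem subset_of_completeEdges_subset {m : ℕ} {W W' : Finset (Fin m)} (hW : 2 ≤ W.card)
    (h : completeEdges W ⊆ completeEdges W') : W ⊆ W' := by
  intro a ha
  obtain ⟨b, hb, hba⟩ := Finset.exists_mem_ne hW a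
  exact (mk_mem_completeEdges.1 (h (mk_mem_completeEdges.2 ⟨ha, hb, hba.symm⟩))).1

/-- A graph with at most as many edges as the complete graph on `n + 1` vertices, but not
containing that graph, has a vertex of degree less than `n` in each of its induced subgraphs. -/
theorem exists_degree_lt {m n : ℕ} {F : Finset (Sym2 (Fin m))}
    (hF : F.card ≤ (n + 1).choose 2)
    (hK : ∀ W : Finset (Fin m), W.card = n + 1 → ¬ completeEdges W ⊆ F)
    {W : Finset (Fin m)} (hW : W.Nonempty) :
    ∃ v ∈ W, (W.filter fun w => v ≠ w ∧ s(v, w) ∈ F).card < n := by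
  by_contra! hdeg
  -- Double counting of oriented edges: if all degrees are at least `n`, then `|W| n ≤ |D| ≤ 2|F| ≤
  -- n (n + 1)`. So `|W| = n + 1`, every degree is maximal, and `W` is a forbidden clique.
  set D := W.offDiag.filter fun p => s(p.1, p.2) ∈ F with hD
  have h1 : W.card * n ≤ D.card := by
    rw [Finset.card_eq_sum_card_fiberwise (f := Prod.fst) (t := W)]
    · rw [← smul_eq_mul]
      refine Finset.card_nsmul_le_sum _ _ _ fun v hv => (hdeg v hv).trans ?_
      refine Finset.card_le_card_of_injOn (fun w => (v, w)) ?_ ?_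
      · intro w hw
        simp only [Finset.coe_filter, Set.mem_ofPred_eq] at hw
        simp [hD, hv, hw]
      · intro a _ b _ hab
        simpa using hab
    · intro p hp
      simp only [hD, Finset.coe_filter, Finset.mem_offDiag, Set.mem_ofPred_eq] at hp
      exact hp.1.1
  have h2 : D.card ≤ 2 * F.card := by
    refine Finset.card_le_mul_card_image_of_maps_to (f := fun p => s(p.1, p.2)) ?_ 2 ?_
    · intro p hp
      exact (Finset.mem_filter.1 hp).2
    · intro e _
      induction e using Sym2.inductionOn with
      | _ a b =>
        refine (Finset.card_le_card (t := {(a, b), (b, a)}) ?_).trans Finset.card_le_two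
        intro p hp
        have := (Finset.mem_filter.1 hp).2
        rw [Sym2.eq_iff] at this
        rcases this with ⟨h, h'⟩ | ⟨h, h'⟩
        · simp [← h, ← h']
        · simp [← h, ← h']
  have h3 : 2 * (n + 1).choose 2 = n * (n + 1) := by
    rw [Nat.choose_two_right, Nat.mul_div_cancel' (Nat.even_mul_pred_self _).two_dvd]
    simp [mul_comm]
  have hsub : ∀ v, (W.filter fun w => v ≠ w ∧ s(v, w) ∈ F) ⊆ W.erase v := by
    intro v w hw
    simp only [Finset.mem_filter] at hw
    exact Finset.mem_erase.2 ⟨hw.2.1.symm, hw.1⟩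
  obtain ⟨v, hv⟩ := hW
  have hlow := (hdeg v hv).trans (Finset.card_le_card (hsub v))
  rw [Finset.card_erase_of_mem hv] at hlow
  have hpos := Finset.card_pos.2 ⟨v, hv⟩
  have hn : 0 < n := by
    rcases Nat.eq_zero_or_pos n with rfl | h
    · exfalso
      refine hK {v} rfl fun e he => ?_
      induction e using Sym2.inductionOn with
      | _ a b => simp [mk_mem_completeEdges] at he; omega
    · exact h
  have hcard : W.card = n + 1 := by
    have : W.card * n ≤ (n + 1) * n := by
      calc W.card * n ≤ 2 * F.card := h1.trans h2
        _ ≤ 2 * (n + 1).choose 2 := by omega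
        _ = (n + 1) * n := by rw [h3, mul_comm]
    have := Nat.le_of_mul_le_mul_right this hn
    omega
  refine hK W hcard fun e he => ?_
  induction e using Sym2.inductionOn with
  | _ a b =>
    obtain ⟨ha, hb, hab⟩ := mk_mem_completeEdges.1 he
    have heq := Finset.eq_of_subset_of_card_le (hsub a)
      (by rw [Finset.card_erase_of_mem ha, hcard]; exact hdeg a ha)
    have : b ∈ W.erase a := Finset.mem_erase.2 ⟨hab.symm, hb⟩
    rw [← heq] at this
    exact (Finset.mem_filter.1 this).2.2

theorem exists_unit_orthogonal {n : ℕ} (T : Finset (EuclideanSpace ℝ (Fin n)))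
    (hT : T.card < n) : ∃ u : EuclideanSpace ℝ (Fin n), ‖u‖ = 1 ∧ ∀ v ∈ T, inner ℝ v u = 0 := by
  have hlt : Module.finrank ℝ (Submodule.span ℝ (T : Set (EuclideanSpace ℝ (Fin n)))) <
      Module.finrank ℝ (EuclideanSpace ℝ (Fin n)) := by
    rw [finrank_euclideanSpace_fin]
    exact (finrank_span_finset_le_card T).trans_lt hT
  have hne : (Submodule.span ℝ (T : Set (EuclideanSpace ℝ (Fin n))))ᗮ ≠ ⊥ := by
    intro h
    rw [Submodule.orthogonal_eq_bot_iff] at h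
    rw [h, finrank_top] at hlt
    exact lt_irrefl _ hlt
  obtain ⟨w, hw, hw0⟩ := Submodule.exists_mem_ne_zero_of_ne_bot hne
  refine ⟨(‖w‖⁻¹ : ℝ) • w, by simp [norm_smul, hw0], fun v hv => ?_⟩
  rw [inner_smul_right, (Submodule.mem_orthogonal _ _).1 hw v (Submodule.subset_span hv), mul_zero]

/-- A graph that is as small as the complete graph on `n + 1` vertices but does not contain it has
an orthonormal labelling in dimension `n`, in which adjacent vertices are orthogonal. -/
theorem exists_unit_orthogonal_on_edges {m n : ℕ} (hn : 0 < n) {F : Finset (Sym2 (Fin m))}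
    (hF : F.card ≤ (n + 1).choose 2)
    (hK : ∀ W : Finset (Fin m), W.card = n + 1 → ¬ completeEdges W ⊆ F) :
    ∃ y : Fin m → EuclideanSpace ℝ (Fin n), (∀ i, ‖y i‖ = 1) ∧
      ∀ a b, a ≠ b → s(a, b) ∈ F → inner ℝ (y a) (y b) = 0 := by
  suffices h : ∀ (k : ℕ) (W : Finset (Fin m)), W.card = k →
      ∃ y : Fin m → EuclideanSpace ℝ (Fin n), (∀ i, ‖y i‖ = 1) ∧
        ∀ a ∈ W, ∀ b ∈ W, a ≠ b → s(a, b) ∈ F → inner ℝ (y a) (y b) = 0 by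
    obtain ⟨y, hy, hyF⟩ := h _ Finset.univ rfl
    exact ⟨y, hy, fun a b => hyF a (Finset.mem_univ a) b (Finset.mem_univ b)⟩
  intro k
  induction k with
  | zero =>
    intro W hW
    rw [Finset.card_eq_zero] at hW
    subst hW
    exact ⟨fun _ => EuclideanSpace.single ⟨0, hn⟩ 1, by simp, by simp⟩
  | succ k ih =>
    intro W hW
    -- Remove a vertex with fewer than `n` neighbours, label the rest, and choose its vector
    -- orthogonal to those of its neighbours.
    obtain ⟨v, hv, hdeg⟩ := exists_degree_lt hF hK (W := W) (Finset.card_pos.1 (by omega))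
    obtain ⟨y, hy, hyF⟩ := ih (W.erase v) (by rw [Finset.card_erase_of_mem hv]; omega)
    classical
    obtain ⟨u, hu, huo⟩ := exists_unit_orthogonal
      ((W.filter fun w => v ≠ w ∧ s(v, w) ∈ F).image y) (Finset.card_image_le.trans_lt hdeg)
    have huo' : ∀ b ∈ W, v ≠ b → s(v, b) ∈ F → inner ℝ (y b) u = 0 := fun b hb hvb hF =>
      huo _ (Finset.mem_image_of_mem _ (Finset.mem_filter.2 ⟨hb, hvb, hF⟩))
    refine ⟨Function.update y v u, fun i => ?_, fun a ha b hb hab habF => ?_⟩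
    · by_cases hi : i = v
      · subst hi; simpa
      · simp [hi, hy]
    · by_cases hav : a = v
      · subst hav
        rw [Function.update_self, Function.update_of_ne hab.symm, real_inner_comm]
        exact huo' b hb hab habF
      · by_cases hbv : b = v
        · subst hbv
          rw [Function.update_self, Function.update_of_ne hab]
          exact huo' a ha hab.symm (Sym2.eq_swap ▸ habF)
        · rw [Function.update_of_ne hav, Function.update_of_ne hbv]
          exact hyF a (Finset.mem_erase.2 ⟨hav, ha⟩) b (Finset.mem_erase.2 ⟨hbv, hb⟩) hab habF

/-! ### Permuted entries and cliques -/

/-- The entry of a matrix at an unordered pair of indices, for a chosen order of the pair. -/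
noncomputable def entry {m : ℕ} (A : Matrix (Fin m) (Fin m) ℝ) (e : Sym2 (Fin m)) : ℝ :=
  A (Quot.out e).1 (Quot.out e).2

theorem entry_mk {m : ℕ} {A : Matrix (Fin m) (Fin m) ℝ} (hA : A.IsSymm) (i j : Fin m) :
    entry A s(i, j) = A i j := by
  have h : s((Quot.out s(i, j)).1, (Quot.out s(i, j)).2) = s(i, j) := Quot.out_eq s(i, j)
  rw [entry]
  rcases Sym2.eq_iff.1 h with ⟨h1, h2⟩ | ⟨h1, h2⟩
  · rw [h1, h2]
  · rw [h1, h2, hA.apply]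

theorem isSymm_gram {m n : ℕ} (y : Fin m → EuclideanSpace ℝ (Fin n)) :
    (Matrix.gram ℝ y).IsSymm := by
  ext i j
  simp [real_inner_comm]

/-- The symmetric matrix obtained by moving the entry at `e` to `ρ e`, for each unordered pair of
indices `e`. -/
noncomputable def permuteEntries {m : ℕ} (ρ : Equiv.Perm (Sym2 (Fin m)))
    (A : Matrix (Fin m) (Fin m) ℝ) : Matrix (Fin m) (Fin m) ℝ :=
  Matrix.of fun i j => entry A (ρ.symm s(i, j))

/-- The principal minor of a matrix on a finite set of indices. -/
noncomputable def principalMinor {m : ℕ} (S : Finset (Fin m)) (A : Matrix (Fin m) (Fin m) ℝ) : ℝ :=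
  (A.submatrix (Subtype.val : S → Fin m) Subtype.val).det

/-- All principal minors of size `n + 1` of the matrices obtained by permuting with `ρ` the entries
of Gram matrices of unit vectors in `ℝⁿ` vanish. -/
def MinorsVanish {m : ℕ} (n : ℕ) (ρ : Equiv.Perm (Sym2 (Fin m))) : Prop :=
  ∀ y : Fin m → EuclideanSpace ℝ (Fin n), (∀ i, ‖y i‖ = 1) → ∀ S : Finset (Fin m),
    S.card = n + 1 → principalMinor S (permuteEntries ρ (Matrix.gram ℝ y)) = 0

theorem symm_diag {m : ℕ} {ρ : Equiv.Perm (Sym2 (Fin m))} (hd : ∀ i, ρ s(i, i) = s(i, i))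
    (i : Fin m) : ρ.symm s(i, i) = s(i, i) := by
  rw [Equiv.symm_apply_eq, hd]

theorem symm_ne {m : ℕ} {ρ : Equiv.Perm (Sym2 (Fin m))} (hd : ∀ i, ρ s(i, i) = s(i, i))
    {i j a b : Fin m} (hij : i ≠ j) (h : ρ.symm s(i, j) = s(a, b)) : a ≠ b := by
  rintro rfl
  rw [Equiv.symm_apply_eq, hd, Sym2.eq_iff] at h
  omega

theorem exists_apply_eq {m : ℕ} {ρ : Equiv.Perm (Sym2 (Fin m))} (hd : ∀ i, ρ s(i, i) = s(i, i))
    {a b : Fin m} (hab : a ≠ b) : ∃ i j, i ≠ j ∧ ρ s(a, b) = s(i, j) := by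
  obtain ⟨i, j, hij⟩ : ∃ i j, ρ s(a, b) = s(i, j) := by
    induction ρ s(a, b) using Sym2.inductionOn with
    | _ i j => exact ⟨i, j, rfl⟩
  refine ⟨i, j, ?_, hij⟩
  rintro rfl
  rw [← hd i, ρ.injective.eq_iff, Sym2.eq_iff] at hij
  omega

/-- A permutation of the edges under which the minors vanish maps every clique with `n + 1`
vertices into such a clique. -/
theorem MinorsVanish.exists_completeEdges {m n : ℕ} (hn : 0 < n) {ρ : Equiv.Perm (Sym2 (Fin m))}
    (hd : ∀ i, ρ s(i, i) = s(i, i)) (h : MinorsVanish n ρ) (W : Finset (Fin m))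
    (hW : W.card = n + 1) :
    ∃ S : Finset (Fin m), S.card = n + 1 ∧ completeEdges W = (completeEdges S).image ρ.symm := by
  have step : ∀ S : Finset (Fin m), S.card = n + 1 →
      ∃ W : Finset (Fin m), W.card = n + 1 ∧
        completeEdges W = (completeEdges S).image ρ.symm := by
    intro S hS
    have hcard : ((completeEdges S).image ρ.symm).card = (n + 1).choose 2 := by
      rw [Finset.card_image_of_injective _ ρ.symm.injective, card_completeEdges, hS]
    -- The preimage of a clique has exactly `(n + 1).choose 2` edges, so if it is not a clique it
    -- contains none on `n + 1` vertices. An orthonormal labelling then turns the minor on `S` into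
    -- the determinant of the identity.
    by_contra! hcon
    obtain ⟨y, hy, hyo⟩ := exists_unit_orthogonal_on_edges hn hcard.le (fun W hW hsub =>
      hcon W hW (Finset.eq_of_subset_of_card_le hsub (by rw [hcard, card_completeEdges, hW])))
    have hone : (permuteEntries ρ (Matrix.gram ℝ y)).submatrix (Subtype.val : S → Fin m)
        (Subtype.val : S → Fin m) = 1 := by
      ext ⟨i, hi⟩ ⟨j, hj⟩
      simp only [permuteEntries, Matrix.submatrix_apply, Matrix.of_apply, Matrix.one_apply,
        Subtype.mk.injEq]
      split_ifs with hij
      · subst hij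
        rw [symm_diag hd, entry_mk (isSymm_gram y)]
        simp [hy]
      · have hmem := Finset.mem_image_of_mem ρ.symm (mk_mem_completeEdges.2 ⟨hi, hj, hij⟩)
        generalize he : ρ.symm s(i, j) = e at hmem
        induction e using Sym2.inductionOn with
        | _ a b =>
          rw [entry_mk (isSymm_gram y)]
          exact hyo a b (symm_ne hd hij he) hmem
    have := h y hy S hS
    rw [principalMinor, hone, Matrix.det_one] at this
    exact one_ne_zero this
  choose! Φ hΦ hΦe using step
  -- So far each `S` has a `W`; the converse holds because an injective self-map of a finite set is
  -- surjective.
  let Ψ : {S : Finset (Fin m) // S.card = n + 1} → {S : Finset (Fin m) // S.card = n + 1} :=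
    fun S => ⟨Φ S.1, hΦ S.1 S.2⟩
  have hinj : Function.Injective Ψ := by
    rintro ⟨S, hS⟩ ⟨S', hS'⟩ hSS
    have h1 : Φ S = Φ S' := congrArg Subtype.val hSS
    have h2 : completeEdges S = completeEdges S' := by
      apply Finset.image_injective ρ.symm.injective
      rw [← hΦe S hS, ← hΦe S' hS', h1]
    have := subset_of_completeEdges_subset (by omega) h2.subset
    exact Subtype.ext (Finset.eq_of_subset_of_card_le this (hS'.trans hS.symm).le)
  obtain ⟨⟨S, hS⟩, hSW⟩ := Finite.injective_iff_surjective.1 hinj ⟨W, hW⟩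
  exact ⟨S, hS, by rw [← hΦe S hS]; exact congrArg (completeEdges ·.1) hSW.symm⟩

/-! ### Test configurations and positive definite matrices -/

/-- Three unit vectors in a coordinate plane, completed on `W` by an orthonormal system of the
orthogonal complement of that plane. -/
theorem exists_plane_configuration {m n : ℕ} (hn : 2 ≤ n) {W : Finset (Fin m)}
    (hW : W.card = n + 1) {a b c : Fin m} (ha : a ∈ W) (hb : b ∈ W) (hc : c ∈ W)
    (hab : a ≠ b) (hac : a ≠ c) (hbc : b ≠ c) {p q r : ℝ × ℝ}
    (hp : p.1 ^ 2 + p.2 ^ 2 = 1) (hq : q.1 ^ 2 + q.2 ^ 2 = 1) (hr : r.1 ^ 2 + r.2 ^ 2 = 1) :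
    ∃ y : Fin m → EuclideanSpace ℝ (Fin n), (∀ i, ‖y i‖ = 1) ∧
      inner ℝ (y a) (y b) = p.1 * q.1 + p.2 * q.2 ∧
      inner ℝ (y a) (y c) = p.1 * r.1 + p.2 * r.2 ∧
      inner ℝ (y b) (y c) = q.1 * r.1 + q.2 * r.2 ∧
      ∀ i ∈ W, ∀ j ∈ W, i ≠ j → i ∉ ({a, b, c} : Finset (Fin m)) → inner ℝ (y i) (y j) = 0 := by
  let k0 : Fin n := ⟨0, by omega⟩
  let k1 : Fin n := ⟨1, by omega⟩
  have h01 : k0 ≠ k1 := by simp [k0, k1]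
  -- There are `n - 2` vertices left in `W`, exactly as many as the coordinates left outside the
  -- plane.
  have hcard : (W \ {a, b, c}).card ≤ (({k0, k1} : Finset (Fin n))ᶜ).card := by
    rw [Finset.card_compl, Finset.card_pair h01, Finset.card_sdiff_of_subset, hW,
      Finset.card_eq_three.2 ⟨a, b, c, hab, hac, hbc, rfl⟩, Fintype.card_fin]
    · omega
    · intro x hx
      simp only [Finset.mem_insert, Finset.mem_singleton] at hx
      rcases hx with rfl | rfl | rfl <;> assumption
  obtain ⟨f, hf⟩ : ∃ f : Fin m → Fin n,
      (∀ i ∈ W \ {a, b, c}, f i ∈ (({k0, k1} : Finset (Fin n))ᶜ)) ∧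
      Set.InjOn f (W \ {a, b, c} : Finset (Fin m)) := by
    obtain ⟨g⟩ : Nonempty ((W \ {a, b, c} : Finset (Fin m)) ↪
        (({k0, k1} : Finset (Fin n))ᶜ : Finset (Fin n))) :=
      Function.Embedding.nonempty_of_card_le (by rwa [Fintype.card_coe, Fintype.card_coe])
    refine ⟨fun i => if h : i ∈ W \ {a, b, c} then (g ⟨i, h⟩ : Fin n) else k0, ?_, ?_⟩
    · intro i hi
      simp only [dif_pos hi]
      exact (g ⟨i, hi⟩).2
    · intro i hi j hj hij
      simp only [dif_pos (Finset.mem_coe.1 hi), dif_pos (Finset.mem_coe.1 hj)] at hij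
      simpa using g.injective (Subtype.ext hij)
  let P : ℝ × ℝ → EuclideanSpace ℝ (Fin n) := fun t =>
    EuclideanSpace.single k0 t.1 + EuclideanSpace.single k1 t.2
  have hPP : ∀ s t, inner ℝ (P s) (P t) = s.1 * t.1 + s.2 * t.2 := by
    intro s t
    simp [P, inner_add_left, inner_add_right, EuclideanSpace.inner_single_left, h01, h01.symm]
  have hP1 : ∀ t : ℝ × ℝ, t.1 ^ 2 + t.2 ^ 2 = 1 → ‖P t‖ = 1 := by
    intro t ht
    have := real_inner_self_eq_norm_sq (P t)
    rw [hPP] at this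
    nlinarith [norm_nonneg (P t)]
  let y : Fin m → EuclideanSpace ℝ (Fin n) := fun i =>
    if i = a then P p else if i = b then P q else if i = c then P r else
      EuclideanSpace.single (f i) 1
  have hya : y a = P p := by simp [y]
  have hyb : y b = P q := by simp [y, hab.symm]
  have hyc : y c = P r := by simp [y, hac.symm, hbc.symm]
  have hyo : ∀ i, i ∉ ({a, b, c} : Finset (Fin m)) → y i = EuclideanSpace.single (f i) 1 := by
    intro i hi
    simp only [Finset.mem_insert, Finset.mem_singleton, not_or] at hi
    simp [y, hi]
  refine ⟨y, fun i => ?_, ?_, ?_, ?_, ?_⟩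
  · by_cases hi : i ∈ ({a, b, c} : Finset (Fin m))
    · simp only [Finset.mem_insert, Finset.mem_singleton] at hi
      rcases hi with rfl | rfl | rfl
      · rw [hya, hP1 p hp]
      · rw [hyb, hP1 q hq]
      · rw [hyc, hP1 r hr]
    · rw [hyo i hi]; simp
  · rw [hya, hyb, hPP]
  · rw [hya, hyc, hPP]
  · rw [hyb, hyc, hPP]
  · intro i hi j hj hij hi3
    have hfi := hf.1 i (Finset.mem_sdiff.2 ⟨hi, hi3⟩)
    simp only [Finset.mem_compl, Finset.mem_insert, Finset.mem_singleton, not_or] at hfi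
    have hfP : ∀ t, inner ℝ (y i) (P t) = 0 := by
      intro t
      simp [hyo i hi3, P, inner_add_right, EuclideanSpace.inner_single_left, hfi.1, hfi.2]
    by_cases hj3 : j ∈ ({a, b, c} : Finset (Fin m))
    · simp only [Finset.mem_insert, Finset.mem_singleton] at hj3
      rcases hj3 with rfl | rfl | rfl
      · rw [hya, hfP]
      · rw [hyb, hfP]
      · rw [hyc, hfP]
    · have hne : f i ≠ f j := fun h => hij (hf.2
        (Finset.mem_coe.2 (Finset.mem_sdiff.2 ⟨hi, hi3⟩))
        (Finset.mem_coe.2 (Finset.mem_sdiff.2 ⟨hj, hj3⟩)) h)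
      rw [hyo i hi3, hyo j hj3]
      simp [EuclideanSpace.inner_single_left, hne]

/-- The symmetric matrix with off-diagonal entry `w` at a given edge and zeros elsewhere. -/
def edgeMatrix {m : ℕ} (p q : Fin m) (w : ℝ) : Matrix (Fin m) (Fin m) ℝ :=
  Matrix.single p q w + Matrix.single q p w

theorem edgeMatrix_apply {m : ℕ} {p q : Fin m} (hpq : p ≠ q) (w : ℝ) (i j : Fin m) :
    edgeMatrix p q w i j = if s(i, j) = s(p, q) then w else 0 := by
  simp only [edgeMatrix, Matrix.add_apply, Matrix.single_apply, Sym2.eq_iff]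
  by_cases h1 : p = i ∧ q = j
  · obtain ⟨rfl, rfl⟩ := h1
    simp [hpq]
  · by_cases h2 : q = i ∧ p = j
    · obtain ⟨rfl, rfl⟩ := h2
      simp [hpq.symm]
    · rw [if_neg h1, if_neg h2, if_neg, add_zero]
      rintro (⟨rfl, rfl⟩ | ⟨rfl, rfl⟩)
      · exact h1 ⟨rfl, rfl⟩
      · exact h2 ⟨rfl, rfl⟩

theorem isSymm_edgeMatrix {m : ℕ} (p q : Fin m) (w : ℝ) : (edgeMatrix p q w).IsSymm := by
  simp [Matrix.IsSymm, edgeMatrix, Matrix.transpose_single, add_comm]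

theorem dotProduct_edgeMatrix_mulVec {m : ℕ} (p q : Fin m) (w : ℝ) (x : Fin m → ℝ) :
    x ⬝ᵥ (edgeMatrix p q w *ᵥ x) = 2 * w * (x p * x q) := by
  simp only [edgeMatrix, Matrix.add_mulVec, dotProduct_add, Matrix.single_mulVec]
  simp [dotProduct, Function.update_apply]
  ring

/-- The constant `9/10` is any bound below `1` that also exceeds the `4/5` and `√3/2` needed for the
two test matrices. -/
theorem posDef_one_add {m : ℕ} {K : Matrix (Fin m) (Fin m) ℝ} (hK : K.IsSymm)
    (h : ∀ x : Fin m → ℝ, -(9 / 10 * ∑ i, x i ^ 2) ≤ x ⬝ᵥ (K *ᵥ x)) : (1 + K).PosDef := by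
  refine .of_dotProduct_mulVec_pos ?_ fun x hx => ?_
  · rw [Matrix.IsHermitian, Matrix.conjTranspose_eq_transpose_of_trivial, Matrix.transpose_add,
      Matrix.transpose_one, hK]
  · have hpos : 0 < ∑ i, x i ^ 2 := by
      obtain ⟨i, hi⟩ := Function.ne_iff.1 hx
      exact Finset.sum_pos' (fun _ _ => sq_nonneg _)
        ⟨i, Finset.mem_univ i, by have : x i ≠ 0 := hi; positivity⟩
    rw [star_trivial, Matrix.add_mulVec, Matrix.one_mulVec, dotProduct_add]
    have h1 : x ⬝ᵥ x = ∑ i, x i ^ 2 := by simp [dotProduct, sq]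
    rw [h1]
    linarith [h x]

theorem sum_four_sq_le {m : ℕ} (x : Fin m → ℝ) {p q r s : Fin m} (h : [p, q, r, s].Nodup) :
    x p ^ 2 + x q ^ 2 + x r ^ 2 + x s ^ 2 ≤ ∑ i, x i ^ 2 := by
  simp only [List.nodup_cons, List.mem_cons, List.not_mem_nil, or_false, not_or,
    List.nodup_nil, and_true, not_false_eq_true] at h
  obtain ⟨⟨h1, h2, h3⟩, ⟨h4, h5⟩, h6⟩ := h
  have : ∑ i ∈ {p, q, r, s}, x i ^ 2 = x p ^ 2 + x q ^ 2 + x r ^ 2 + x s ^ 2 := by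
    rw [Finset.sum_insert (by simp [*]), Finset.sum_insert (by simp [*]),
      Finset.sum_pair h6]
    ring
  rw [← this]
  exact Finset.sum_le_sum_of_subset_of_nonneg (Finset.subset_univ _) fun _ _ _ => sq_nonneg _

/-- Disjoint edges do not interact: `2w x_p x_q ≥ -w (x_p² + x_q²)` for each, with weights at most
`4/5`. -/
theorem posDef_matching {m : ℕ} {p q r s : Fin m} (h : [p, q, r, s].Nodup) :
    (1 + (edgeMatrix p q (3 / 5) + edgeMatrix r s (4 / 5))).PosDef := by
  refine posDef_one_add ((isSymm_edgeMatrix _ _ _).add (isSymm_edgeMatrix _ _ _)) fun x => ?_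
  rw [Matrix.add_mulVec, dotProduct_add, dotProduct_edgeMatrix_mulVec, dotProduct_edgeMatrix_mulVec]
  nlinarith [sum_four_sq_le x h, sq_nonneg (x p + x q), sq_nonneg (x r + x s), sq_nonneg (x p),
    sq_nonneg (x q), sq_nonneg (x r), sq_nonneg (x s)]

/-- The three edges at `c` form a matrix with least eigenvalue `-√3/2 > -1`. The same weights on a
triangle would give a singular matrix. -/
theorem posDef_star {m : ℕ} {c p q r : Fin m} (h : [c, p, q, r].Nodup) :
    (1 + (edgeMatrix c p (-1 / 2) + edgeMatrix c q (-1 / 2) + edgeMatrix c r (-1 / 2))).PosDef := by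
  refine posDef_one_add (((isSymm_edgeMatrix _ _ _).add (isSymm_edgeMatrix _ _ _)).add
    (isSymm_edgeMatrix _ _ _)) fun x => ?_
  simp only [Matrix.add_mulVec, dotProduct_add, dotProduct_edgeMatrix_mulVec]
  nlinarith [sum_four_sq_le x h, sq_nonneg (9 / 5 * x p - x c), sq_nonneg (9 / 5 * x q - x c),
    sq_nonneg (9 / 5 * x r - x c), sq_nonneg (x c)]

theorem principalMinor_pos_of_posDef {m : ℕ} {S : Finset (Fin m)}
    {A K : Matrix (Fin m) (Fin m) ℝ} (hK : K.PosDef) (h : ∀ i ∈ S, ∀ j ∈ S, A i j = K i j) :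
    0 < principalMinor S A := by
  have : A.submatrix (Subtype.val : S → Fin m) (Subtype.val : S → Fin m) =
      K.submatrix (Subtype.val : S → Fin m) (Subtype.val : S → Fin m) := by
    ext i j
    exact h i i.2 j j.2
  rw [principalMinor, this]
  exact (hK.submatrix Subtype.val_injective).det_pos

/-! ### Adjacency and triangles are preserved -/

/-- The entries of a permuted Gram matrix on the image `S` of a clique `W`, for a configuration in
which all edges in `W` but those of a given triangle are orthogonal. -/
theorem permuteEntries_gram_apply {m n : ℕ} {ρ : Equiv.Perm (Sym2 (Fin m))}
    (hd : ∀ i, ρ s(i, i) = s(i, i)) {W S : Finset (Fin m)}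
    (hWS : completeEdges W = (completeEdges S).image ρ.symm) {a b c : Fin m}
    {y : Fin m → EuclideanSpace ℝ (Fin n)} (hy : ∀ i, ‖y i‖ = 1)
    (ho : ∀ i ∈ W, ∀ j ∈ W, i ≠ j → i ∉ ({a, b, c} : Finset (Fin m)) → inner ℝ (y i) (y j) = 0)
    (hab : a ≠ b) (hac : a ≠ c) (hbc : b ≠ c)
    {i j : Fin m} (hi : i ∈ S) (hj : j ∈ S) :
    permuteEntries ρ (Matrix.gram ℝ y) i j = (if i = j then 1 else 0) +
      ((if s(i, j) = ρ s(a, b) then inner ℝ (y a) (y b) else 0) +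
        (if s(i, j) = ρ s(a, c) then inner ℝ (y a) (y c) else 0) +
        (if s(i, j) = ρ s(b, c) then inner ℝ (y b) (y c) else 0)) := by
  simp only [permuteEntries, Matrix.of_apply, ← Equiv.symm_apply_eq]
  by_cases hij : i = j
  · subst hij
    simp [symm_diag hd, entry_mk (isSymm_gram y), hy]
    grind
  · have hmem := Finset.mem_image_of_mem ρ.symm (mk_mem_completeEdges.2 ⟨hi, hj, hij⟩)
    rw [← hWS] at hmem
    generalize ρ.symm s(i, j) = e at hmem
    induction e using Sym2.inductionOn with
    | _ u v =>
      rw [entry_mk (isSymm_gram y), Matrix.gram_apply]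
      obtain ⟨hu, hv, huv⟩ := mk_mem_completeEdges.1 hmem
      have h1 := ho u hu v hv huv
      have h2 := ho v hv u hu huv.symm
      rw [real_inner_comm] at h2
      simp only [Finset.mem_insert, Finset.mem_singleton] at h1 h2
      simp only [Sym2.eq_iff, hij, if_false, zero_add]
      by_cases hu3 : u = a ∨ u = b ∨ u = c
      · by_cases hv3 : v = a ∨ v = b ∨ v = c
        · rcases hu3 with rfl | rfl | rfl <;> rcases hv3 with rfl | rfl | rfl <;>
            first
            | exact absurd rfl huv
            | (simp [hab, hac, hbc, hab.symm, hac.symm, hbc.symm]; done)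
            | (rw [real_inner_comm]; simp [hab, hac, hbc, hab.symm, hac.symm, hbc.symm])
        · rw [h2 hv3]
          push Not at hv3
          simp [hv3]
      · rw [h1 hu3]
        push Not at hu3
        simp [hu3]

theorem MinorsVanish.exists_clique_pair {m n : ℕ} (hn : 2 ≤ n) (hnm : n < m)
    {ρ : Equiv.Perm (Sym2 (Fin m))} (hd : ∀ i, ρ s(i, i) = s(i, i)) (h : MinorsVanish n ρ)
    (a b c : Fin m) :
    ∃ W S : Finset (Fin m), W.card = n + 1 ∧ S.card = n + 1 ∧ a ∈ W ∧ b ∈ W ∧ c ∈ W ∧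
      completeEdges W = (completeEdges S).image ρ.symm := by
  obtain ⟨W, hsub, hW⟩ := Finset.exists_superset_card_eq (s := {a, b, c}) (n := n + 1)
    (Finset.card_le_three.trans (by omega)) (by rw [Fintype.card_fin]; omega)
  obtain ⟨S, hS, hWS⟩ := h.exists_completeEdges (by omega) hd W hW
  exact ⟨W, S, hW, hS, hsub (by simp), hsub (by simp), hsub (by simp), hWS⟩

/-- If the two images were disjoint, a configuration with only these two inner products nonzero
would produce a positive definite matching matrix on `S`, against the vanishing of its minor. -/
theorem MinorsVanish.adjacent {m n : ℕ} (hn : 2 ≤ n) (hnm : n < m)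
    {ρ : Equiv.Perm (Sym2 (Fin m))} (hd : ∀ i, ρ s(i, i) = s(i, i)) (h : MinorsVanish n ρ)
    {a b c : Fin m} (hab : a ≠ b) (hac : a ≠ c) (hbc : b ≠ c) :
    ∃ p q r, p ≠ q ∧ p ≠ r ∧ ρ s(a, b) = s(p, q) ∧ ρ s(a, c) = s(p, r) := by
  obtain ⟨W, S, hW, hS, ha, hb, hc, hWS⟩ := h.exists_clique_pair hn hnm hd a b c
  -- Taking `b`, `c` along the axes kills the edge `bc`; the 3-4-5 triple gives `a` rational
  -- coordinates.
  obtain ⟨y, hy, hyab, hyac, hybc, hyo⟩ := exists_plane_configuration hn hW ha hb hc hab hac hbc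
    (p := (3 / 5, 4 / 5)) (q := (1, 0)) (r := (0, 1)) (by norm_num) (by norm_num) (by norm_num)
  norm_num at hyab hyac hybc
  obtain ⟨p, q, hpq, e1⟩ := exists_apply_eq hd hab
  obtain ⟨r, s, hrs, e2⟩ := exists_apply_eq hd hac
  by_contra! hcon
  have hnd : [p, q, r, s].Nodup := by
    have h1 := hcon p q s hpq
    have h2 := hcon p q r hpq
    have h3 := hcon q p s hpq.symm
    have h4 := hcon q p r hpq.symm
    rw [e1, e2] at h1 h2 h3 h4
    simp only [ne_eq, Sym2.eq_iff] at h1 h2 h3 h4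
    simp only [List.nodup_cons, List.mem_cons, List.not_mem_nil, List.nodup_nil]
    grind
  refine (principalMinor_pos_of_posDef (posDef_matching hnd) fun i hi j hj => ?_).ne' (h y hy S hS)
  rw [permuteEntries_gram_apply hd hWS hy hyo hab hac hbc hi hj, hyab, hyac, hybc, e1, e2,
    Matrix.add_apply, Matrix.add_apply, edgeMatrix_apply hpq, edgeMatrix_apply hrs,
    Matrix.one_apply]
  simp

/-- Three pairwise adjacent edges form a triangle or a star. Unit vectors at mutual angles of 120°
exclude the star, whose matrix is positive definite. -/
theorem MinorsVanish.triangle {m n : ℕ} (hn : 2 ≤ n) (hnm : n < m)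
    {ρ : Equiv.Perm (Sym2 (Fin m))} (hd : ∀ i, ρ s(i, i) = s(i, i)) (h : MinorsVanish n ρ)
    {a b c : Fin m} (hab : a ≠ b) (hac : a ≠ c) (hbc : b ≠ c) :
    ∃ p q r, p ≠ q ∧ p ≠ r ∧ q ≠ r ∧
      ρ s(a, b) = s(p, q) ∧ ρ s(a, c) = s(p, r) ∧ ρ s(b, c) = s(q, r) := by
  obtain ⟨W, S, hW, hS, ha, hb, hc, hWS⟩ := h.exists_clique_pair hn hnm hd a b c
  have h3 : Real.sqrt 3 * Real.sqrt 3 = 3 := Real.mul_self_sqrt (by norm_num)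
  obtain ⟨y, hy, hyab, hyac, hybc, hyo⟩ := exists_plane_configuration hn hW ha hb hc hab hac hbc
    (p := (1, 0)) (q := (-1 / 2, Real.sqrt 3 / 2)) (r := (-1 / 2, -(Real.sqrt 3 / 2)))
    (by norm_num) (by dsimp only; nlinarith) (by dsimp only; nlinarith)
  replace hyab : inner ℝ (y a) (y b) = (-1 / 2 : ℝ) := by rw [hyab]; norm_num
  replace hyac : inner ℝ (y a) (y c) = (-1 / 2 : ℝ) := by rw [hyac]; norm_num
  replace hybc : inner ℝ (y b) (y c) = (-1 / 2 : ℝ) := by rw [hybc]; dsimp only; nlinarith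
  obtain ⟨p, q, r, hpq, hpr, e1, e2⟩ := h.adjacent hn hnm hd hab hac hbc
  have hqr : q ≠ r := by
    rintro rfl
    have := ρ.injective (e1.trans e2.symm)
    rw [Sym2.eq_iff] at this
    grind
  obtain ⟨u, v, huv, e3⟩ := exists_apply_eq hd hbc
  refine ⟨p, q, r, hpq, hpr, hqr, e1, e2, ?_⟩
  have h13 : s(p, q) ≠ s(u, v) := by
    rw [← e1, ← e3]
    intro h
    have := ρ.injective h
    rw [Sym2.eq_iff] at this
    grind
  have h23 : s(p, r) ≠ s(u, v) := by
    rw [← e2, ← e3]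
    intro h
    have := ρ.injective h
    rw [Sym2.eq_iff] at this
    grind
  have adj1 : u = p ∨ u = q ∨ v = p ∨ v = q := by
    obtain ⟨p', q', r', -, -, f1, f2⟩ := h.adjacent hn hnm hd hab.symm hbc hac
    rw [Sym2.eq_swap, e1] at f1
    rw [e3] at f2
    rw [Sym2.eq_iff] at f1 f2
    grind
  have adj2 : u = p ∨ u = r ∨ v = p ∨ v = r := by
    obtain ⟨p', q', r', -, -, f1, f2⟩ := h.adjacent hn hnm hd hac.symm hbc.symm hab
    rw [Sym2.eq_swap, e2] at f1
    rw [Sym2.eq_swap, e3] at f2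
    rw [Sym2.eq_iff] at f1 f2
    grind
  by_contra hne
  rw [e3] at hne
  -- An edge meeting both `pq` and `pr`, but different from `qr`, passes through `p`.
  obtain ⟨t, hpt, et⟩ : ∃ t, p ≠ t ∧ s(u, v) = s(p, t) := by
    simp only [ne_eq, Sym2.eq_iff] at hne h13 h23 ⊢
    by_cases hup : u = p
    · exact ⟨v, by grind⟩
    · exact ⟨u, by grind⟩
  have hnd : [p, q, r, t].Nodup := by
    rw [et] at h13 h23
    simp only [ne_eq, Sym2.eq_iff] at h13 h23
    simp only [List.nodup_cons, List.mem_cons, List.not_mem_nil, List.nodup_nil]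
    grind
  refine (principalMinor_pos_of_posDef (posDef_star hnd) fun i hi j hj => ?_).ne' (h y hy S hS)
  rw [permuteEntries_gram_apply hd hWS hy hyo hab hac hbc hi hj, hyab, hyac, hybc, e1, e2, e3, et,
    Matrix.add_apply, Matrix.add_apply, Matrix.add_apply, edgeMatrix_apply hpq,
    edgeMatrix_apply hpr, edgeMatrix_apply hpt, Matrix.one_apply]

/-- A permutation of the edges of a complete graph that maps triangles to triangles is induced by a
permutation of the vertices. -/
theorem exists_perm_of_triangle {m : ℕ} (hm : 3 ≤ m) {ρ : Equiv.Perm (Sym2 (Fin m))}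
    (hT : ∀ {a b c : Fin m}, a ≠ b → a ≠ c → b ≠ c → ∃ p q r, p ≠ q ∧ p ≠ r ∧ q ≠ r ∧
      ρ s(a, b) = s(p, q) ∧ ρ s(a, c) = s(p, r) ∧ ρ s(b, c) = s(q, r)) :
    ∃ σ : Equiv.Perm (Fin m), ∀ v w, v ≠ w → ρ s(v, w) = s(σ v, σ w) := by
  have third : ∀ v w : Fin m, ∃ x, v ≠ x ∧ w ≠ x := by
    intro v w
    obtain ⟨x, hx⟩ := Finset.exists_mem_notMem_of_card_lt_card (s := {v, w}) (t := Finset.univ)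
      (Finset.card_le_two.trans_lt (by rw [Finset.card_univ, Fintype.card_fin]; omega))
    simp only [Finset.mem_insert, Finset.mem_singleton, not_or] at hx
    exact ⟨x, Ne.symm hx.2.1, Ne.symm hx.2.2⟩
  have common : ∀ v : Fin m, ∃ u, ∀ w, v ≠ w → u ∈ ρ s(v, w) := by
    intro v
    obtain ⟨w₁, hw₁, -⟩ := third v v
    obtain ⟨w₂, hw₂, hw₁₂⟩ := third v w₁
    obtain ⟨p, q, r, hpq, hpr, hqr, e1, e2, e3⟩ := hT hw₁ hw₂ hw₁₂
    refine ⟨p, fun w hw => ?_⟩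
    by_cases h1 : w₁ = w
    · subst h1; simp [e1]
    by_cases h2 : w₂ = w
    · subst h2; simp [e2]
    obtain ⟨p', q', r', -, -, -, f1, f2, -⟩ := hT hw₁ hw h1
    obtain ⟨p'', q'', r'', -, -, -, g1, g2, -⟩ := hT hw₂ hw h2
    -- The image of `vw` meets both `pq` and `pr`; it could miss `p` only by being `qr`, already the
    -- image of `w₁w₂`.
    have hne : ρ s(v, w) ≠ s(q, r) := by
      rw [← e3]
      intro h
      have := ρ.injective h
      rw [Sym2.eq_iff] at this
      grind
    rw [e1] at f1
    rw [e2] at g1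
    rw [f2] at g2 hne ⊢
    rw [Sym2.eq_iff] at f1 g1 g2
    rw [ne_eq, Sym2.eq_iff] at hne
    rw [Sym2.mem_iff]
    grind
  choose σ hσ using common
  -- If `σ v = σ w`, this vertex would lie on all three edges of the image of a triangle through `v`
  -- and `w`.
  have hinj : Function.Injective σ := by
    intro v w hvw
    by_contra hne
    obtain ⟨x, hvx, hwx⟩ := third v w
    obtain ⟨p, q, r, hpq, hpr, hqr, e1, e2, e3⟩ := hT hne hvx hwx
    have h1 := hσ v w hne
    have h2 := hσ v x hvx
    have h3 := hσ w x hwx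
    rw [e1, Sym2.mem_iff] at h1
    rw [e2, Sym2.mem_iff] at h2
    rw [e3, Sym2.mem_iff] at h3
    grind
  refine ⟨Equiv.ofBijective σ (Finite.injective_iff_bijective.1 hinj), fun v w hvw => ?_⟩
  simp only [Equiv.ofBijective_apply]
  refine (Sym2.mem_and_mem_iff (hinj.ne hvw)).1 ⟨hσ v w hvw, ?_⟩
  rw [Sym2.eq_swap]
  exact hσ w v hvw.symm

theorem MinorsVanish.exists_perm {m n : ℕ} (hn : 2 ≤ n) (hnm : n < m)
    {ρ : Equiv.Perm (Sym2 (Fin m))} (hd : ∀ i, ρ s(i, i) = s(i, i)) (h : MinorsVanish n ρ) :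
    ∃ σ : Equiv.Perm (Fin m), ∀ v w, v ≠ w → ρ s(v, w) = s(σ v, σ w) :=
  exists_perm_of_triangle (by omega) (h.triangle hn hnm hd)

/-! ### Defining polynomials and rearrangements -/

/-- The polynomial expressing the difference of the entries at two unordered pairs of indices. -/
noncomputable def entrySubPoly {m : ℕ} (e e' : Sym2 (Fin m)) : MvPolynomial (Fin m × Fin m) ℝ :=
  MvPolynomial.X (Quot.out e) - MvPolynomial.X (Quot.out e')

theorem eval_entrySubPoly {m : ℕ} (e e' : Sym2 (Fin m)) (A : Matrix (Fin m) (Fin m) ℝ) :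
    MvPolynomial.eval (fun p => A p.1 p.2) (entrySubPoly e e') = entry A e - entry A e' := by
  simp [entrySubPoly, entry]

/-- The polynomial expressing a principal minor of the matrix with permuted entries. -/
noncomputable def minorPoly {m : ℕ} (ρ : Equiv.Perm (Sym2 (Fin m))) (S : Finset (Fin m)) :
    MvPolynomial (Fin m × Fin m) ℝ :=
  (Matrix.of fun i j : S => MvPolynomial.X (R := ℝ) (Quot.out (ρ.symm s(i.1, j.1)))).det

theorem eval_minorPoly {m : ℕ} (ρ : Equiv.Perm (Sym2 (Fin m))) (S : Finset (Fin m))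
    (A : Matrix (Fin m) (Fin m) ℝ) :
    MvPolynomial.eval (fun p => A p.1 p.2) (minorPoly ρ S) =
      principalMinor S (permuteEntries ρ A) := by
  rw [minorPoly, RingHom.map_det, principalMinor]
  congr 1
  ext i j
  simp [permuteEntries, entry]

/-- Some endpoint of `e` lies outside `e'`. Making its vector orthogonal to a vector shared by all
other vertices gives entries `0` at `e` and `1` at `e'`. -/
theorem exists_unit_entry_ne {m n : ℕ} (hn : 2 ≤ n) {e e' : Sym2 (Fin m)} (he : ¬ e.IsDiag)
    (hne : e ≠ e') : ∃ y : Fin m → EuclideanSpace ℝ (Fin n), (∀ i, ‖y i‖ = 1) ∧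
      entry (Matrix.gram ℝ y) e ≠ entry (Matrix.gram ℝ y) e' := by
  induction e using Sym2.inductionOn with
  | _ i j =>
  induction e' using Sym2.inductionOn with
  | _ k l =>
    rw [Sym2.mk_isDiag_iff] at he
    have h01 : (⟨0, by omega⟩ : Fin n) ≠ ⟨1, by omega⟩ := by simp
    have key : ∀ i j : Fin m, i ≠ j → i ≠ k → i ≠ l →
        ∃ y : Fin m → EuclideanSpace ℝ (Fin n), (∀ i, ‖y i‖ = 1) ∧
          inner ℝ (y i) (y j) ≠ inner ℝ (y k) (y l) := by
      intro i j hij hik hil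
      refine ⟨fun v => if v = i then EuclideanSpace.single ⟨0, by omega⟩ 1 else
        EuclideanSpace.single ⟨1, by omega⟩ 1, fun v => ?_, ?_⟩
      · dsimp only
        split_ifs <;> simp
      · simp [hij.symm, hik.symm, hil.symm, EuclideanSpace.inner_single_left]
    simp only [entry_mk (isSymm_gram _), Matrix.gram_apply]
    by_cases h : i ≠ k ∧ i ≠ l
    · exact key i j he h.1 h.2
    · obtain ⟨y, hy, hyne⟩ := key j i (Ne.symm he)
        (by rintro rfl; rw [ne_eq, Sym2.eq_iff] at hne; grind)
        (by rintro rfl; rw [ne_eq, Sym2.eq_iff] at hne; grind)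
      exact ⟨y, hy, by rwa [real_inner_comm]⟩

/-- A rearrangement of a matrix with pairwise distinct off-diagonal entries, all different from the
diagonal ones, is given by a permutation of the unordered pairs of indices. -/
theorem IsSymmRearrangement.exists_perm {m : ℕ} {A B : Matrix (Fin m) (Fin m) ℝ}
    (h : IsSymmRearrangement A B)
    (hA : ∀ e e' : Sym2 (Fin m), ¬ e.IsDiag → e ≠ e' → entry A e ≠ entry A e') :
    ∃ ρ : Equiv.Perm (Sym2 (Fin m)), (∀ i, ρ s(i, i) = s(i, i)) ∧
      (∀ e, entry B (ρ e) = entry A e) ∧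
      ∀ i j k l, ρ s(i, j) = s(k, l) →
        (A i i = A k k ∧ A j j = A l l) ∨ (A i i = A l l ∧ A j j = A k k) := by
  obtain ⟨hAs, hBs, hdiag, htr⟩ := h
  -- The last clause sends each diagonal pair to itself: diagonal entries may coincide, so their
  -- values alone would not determine an injective map.
  have key : ∀ e : Sym2 (Fin m), ∃ e' : Sym2 (Fin m), ∃ i j k l, e = s(i, j) ∧ e' = s(k, l) ∧
      A i i = A k k ∧ A j j = A l l ∧ B k l = A i j ∧ (i = j → e' = e) := by
    intro e
    induction e using Sym2.inductionOn with
    | _ i j =>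
      by_cases hij : i = j
      · subst hij
        exact ⟨s(i, i), i, i, i, i, rfl, rfl, rfl, rfl, hdiag i, fun _ => rfl⟩
      · have hmem : (A i i, A j j, A i j) ∈ triples B := htr ▸ ⟨i, j, rfl⟩
        obtain ⟨k, l, hkl⟩ := hmem
        simp only [Prod.mk.injEq, hdiag] at hkl
        exact ⟨s(k, l), i, j, k, l, rfl, rfl, hkl.1, hkl.2.1, hkl.2.2.symm,
          fun h => absurd h hij⟩
  choose g hg using key
  have hgd : ∀ i, g s(i, i) = s(i, i) := by
    intro i
    obtain ⟨a, b, k, l, he, -, -, -, -, h⟩ := hg s(i, i)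
    refine h ?_
    rw [Sym2.eq_iff] at he
    grind
  have hge : ∀ e, entry B (g e) = entry A e := by
    intro e
    obtain ⟨i, j, k, l, he, he', -, -, h, -⟩ := hg e
    rw [he', entry_mk hBs, h]
    conv_rhs => rw [he, entry_mk hAs]
  have hinj : Function.Injective g := by
    intro e e' hee
    by_contra hne
    have heq : entry A e = entry A e' := by rw [← hge, ← hge, hee]
    by_cases he : e.IsDiag
    · by_cases he' : e'.IsDiag
      · induction e using Sym2.inductionOn with
        | _ i j =>
        induction e' using Sym2.inductionOn with
        | _ k l =>
          rw [Sym2.mk_isDiag_iff] at he he'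
          subst he he'
          rw [hgd, hgd] at hee
          exact hne hee
      · exact hA e' e he' (Ne.symm hne) heq.symm
    · exact hA e e' he hne heq
  refine ⟨Equiv.ofBijective g (Finite.injective_iff_bijective.1 hinj), hgd, hge, ?_⟩
  intro i j k l hρ
  obtain ⟨i', j', k', l', he, he', h1, h2, -, -⟩ := hg s(i, j)
  rw [Equiv.ofBijective_apply] at hρ
  rw [hρ] at he'
  rcases Sym2.eq_iff.1 he with ⟨rfl, rfl⟩ | ⟨rfl, rfl⟩ <;>
    rcases Sym2.eq_iff.1 he' with ⟨rfl, rfl⟩ | ⟨rfl, rfl⟩ <;> simp [h1, h2]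

theorem principalMinor_eq_zero_of_rank_le {m n : ℕ} {B : Matrix (Fin m) (Fin m) ℝ}
    (hB : B.rank ≤ n) {S : Finset (Fin m)} (hS : S.card = n + 1) : principalMinor S B = 0 := by
  by_contra hne
  have hu := (Matrix.isUnit_iff_isUnit_det _).2 (isUnit_iff_ne_zero.2 hne)
  have h1 := Matrix.rank_of_isUnit _ hu
  have h2 := Matrix.rank_submatrix_le B (Subtype.val : S → Fin m) (Subtype.val : S → Fin m)
  rw [h1, Fintype.card_coe, hS] at h2
  omega

/-- Pair sums of `d` are preserved, and `2 d i = (d i + d j) + (d i + d k) - (d j + d k)`. A third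
index is essential: on two indices a swap satisfies the hypothesis. -/
theorem apply_diag_eq_of_perm {m : ℕ} (hm : 3 ≤ m) {d : Fin m → ℝ} {σ : Equiv.Perm (Fin m)}
    (h : ∀ i j, i ≠ j → (d i = d (σ i) ∧ d j = d (σ j)) ∨ (d i = d (σ j) ∧ d j = d (σ i)))
    (i : Fin m) : d (σ i) = d i := by
  obtain ⟨j, k, hij, hik, hjk⟩ : ∃ j k : Fin m, i ≠ j ∧ i ≠ k ∧ j ≠ k := by
    obtain ⟨W, hsub, hW⟩ := Finset.exists_superset_card_eq (s := {i}) (n := 3) (by simp)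
      (by simpa using hm)
    have hi : i ∈ W := hsub (by simp)
    obtain ⟨j, k, hjk, h⟩ := Finset.card_eq_two.1
      (show (W.erase i).card = 2 by rw [Finset.card_erase_of_mem hi, hW])
    have hj : j ∈ W.erase i := by simp [h]
    have hk : k ∈ W.erase i := by simp [h]
    exact ⟨j, k, (Finset.ne_of_mem_erase hj).symm, (Finset.ne_of_mem_erase hk).symm, hjk⟩
  have h1 := h i j hij
  have h2 := h i k hik
  have h3 := h j k hjk
  grind

end Beltway

/-! ### The generic set and the conclusion -/

theorem proposition3p2 (m n ℓ : ℕ) (hn : 2 ≤ n) (hnm : n < m) (hl : ℓ ≤ m) :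
    ∃ U : Set (Matrix (Fin m) (Fin m) ℝ),
      Beltway.IsZariskiOpenIn U (Beltway.psdRankDiag m n ℓ) ∧
      Beltway.IsZariskiDenseIn U (Beltway.psdRankDiag m n ℓ) ∧
      ∀ A ∈ U, ∀ B : Matrix (Fin m) (Fin m) ℝ,
        Beltway.IsSymmRearrangement A B → ¬ Beltway.IsGramEquivalent n A B → n < B.rank := by
  classical
  open Beltway in
  let s : Finset (MvPolynomial (Fin m × Fin m) ℝ) :=
    ((Finset.univ.image fun p : Sym2 (Fin m) × Sym2 (Fin m) => entrySubPoly p.1 p.2) ∪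
      (Finset.univ.image fun p : Equiv.Perm (Sym2 (Fin m)) × Finset (Fin m) =>
        minorPoly p.1 p.2)).filter fun f =>
      ∃ y : Fin m → EuclideanSpace ℝ (Fin n), (∀ i, ‖y i‖ = 1) ∧
        MvPolynomial.eval (fun p => Matrix.gram ℝ y p.1 p.2) f ≠ 0
  open Beltway in
  obtain ⟨hopen, hdense⟩ := zariski_open_dense_of_forall_unit ℓ hn s
    (fun f hf => (Finset.mem_filter.1 hf).2)
  refine ⟨_, hopen, hdense, ?_⟩
  rintro A ⟨⟨hpsd, hrank, -⟩, hs⟩ B hAB hneq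
  have hdist : ∀ e e' : Sym2 (Fin m), ¬ e.IsDiag → e ≠ e' →
      Beltway.entry A e ≠ Beltway.entry A e' := by
    intro e e' he hne
    rw [← sub_ne_zero, ← Beltway.eval_entrySubPoly]
    refine hs _ (Finset.mem_filter.2 ⟨Finset.mem_union_left _
      (Finset.mem_image.2 ⟨(e, e'), Finset.mem_univ _, rfl⟩), ?_⟩)
    simpa only [Beltway.eval_entrySubPoly, sub_ne_zero] using
      Beltway.exists_unit_entry_ne hn he hne
  obtain ⟨ρ, hd, hρ, htype⟩ := hAB.exists_perm hdist
  by_contra! hle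
  have hB : B = Beltway.permuteEntries ρ A := by
    ext i j
    rw [← Beltway.entry_mk hAB.2.1 i j, Beltway.permuteEntries, Matrix.of_apply, ← hρ,
      Equiv.apply_symm_apply]
  -- A minor that is nonzero at some unit configuration passes the filter defining `s`, so it is
  -- nonzero at `A`; but the rank of `B` makes it vanish there.
  have hvan : Beltway.MinorsVanish n ρ := by
    intro y hy S hS
    by_contra hne
    rw [← Beltway.eval_minorPoly] at hne
    refine hs (Beltway.minorPoly ρ S) (Finset.mem_filter.2 ⟨Finset.mem_union_right _
      (Finset.mem_image.2 ⟨(ρ, S), Finset.mem_univ _, rfl⟩), y, hy, hne⟩) ?_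
    rw [Beltway.eval_minorPoly, ← hB]
    exact Beltway.principalMinor_eq_zero_of_rank_le hle hS
  obtain ⟨σ, hσ⟩ := hvan.exists_perm hn hnm hd
  have hdiag := Beltway.apply_diag_eq_of_perm (by omega) (d := fun i => A i i) (σ := σ)
    fun i j hij => htype i j _ _ (hσ i j hij)
  have hBA : ∀ i j, B (σ i) (σ j) = A i j := by
    intro i j
    by_cases hij : i = j
    · subst hij
      rw [hAB.2.2.1, hdiag]
    · rw [← Beltway.entry_mk hAB.2.1, ← hσ i j hij, hρ, Beltway.entry_mk hAB.1]
  obtain ⟨x, hx⟩ := Beltway.exists_eq_gram hpsd hrank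
  have hAX := hx.trans (Beltway.gram_eq_colMatrix x)
  -- The inverse appears because `B (σ i) (σ j) = A i j`.
  refine hneq ⟨Beltway.colMatrix x, σ.symm, hAX, ?_⟩
  ext k l
  have h1 : B k l = A (σ.symm k) (σ.symm l) := by
    rw [← hBA, Equiv.apply_symm_apply, Equiv.apply_symm_apply]
  rw [h1, hAX]
  rfl
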